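/- Let $q\in\mathbb C$ with $0<|q|<1$ and write $(a)_n=(a;q)_n=\prod_{i=0}^{n-1}(1-aq^i)$, $(a;q)_\infty=\lim_{n\to\infty}(a;q)_n$, $(a_1,\dots,a_m;q)_n=(a_1;q)_n\cdots(a_m;q)_n$ (for $n\in\mathbb N$ or $n=\infty$), $${}_{r+1}\phi_r\left(\begin{matrix}a_1,\dots,a_{r+1}\\ b_1,\dots,b_r\end{matrix};q,z\right)=\sum_{n=0}^\infty\frac{(a_1,\dots,a_{r+1};q)_n}{(q,b_1,\dots,b_r;q)_n}z^n,$$ and $\left[\begin{matrix}n\\m\end{matrix}\right]=\frac{(q)_n}{(q)_m(q)_{n-m}}$ for $0\le m\le n$ (and $0$ otherwise). Let $\alpha,\beta,\gamma,\delta,\varepsilon,f,t\in\mathbb C$ with $\alpha,\beta,\gamma,\varepsilon,t\ne0$ and $|t|<1$, and suppose that no denominator below vanishes, i.e. for all integers $j\ge0$ none of $\beta,\ \delta,\ f,\ q/\alpha,\ \gamma q/\beta,\ \varepsilon q/\beta,\ \delta q/\beta,\ fq/\beta$ equals $q^{-j}$, and $\alpha t/\beta\ne q^k$ for all $k\in\mathbb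 Z$. (The condition $t\neq q^{-j}$, $j\ge 0$, is implied by $|t|<1$.) Then the series on the left-hand side of the identity below and the ${}_3\phi_2$ series converge absolutely; the ${}_2\phi_1$ series converges absolutely if $|q/\alpha|<1$; the outer series (over $n$) of the triple sum converges absolutely if $|\gamma|,|\varepsilon|,|\gamma q/\beta|,|\varepsilon q/\beta|<1$. Moreover, whenever the ${}_2\phi_1$ series and the outer series of the triple sum converge absolutely (in particular under these conditions), the following identity holds: $$\begin{aligned} \sum_{n=0}^{\infty}\frac{(\alpha)_n(\gamma)_n(\varepsilon)_n}{(\beta)_n(\delta)_n(f)_n}t^n &=\frac{(\varepsilon,\gamma,\beta/\alpha,q,\alpha t,q/(\alpha t),\delta q/\beta,fq/\beta;q)_\infty}{(f,\delta,q/\alpha,\beta,\beta/(\alpha t),\alpha tq/\beta,\gamma q/\beta,\varepsilon q/\beta;q)_\infty}\;{}_3\phi_2\left(\begin{matrix}\frac{\alpha q}{\beta},\frac{\gamma q}{\beta},\frac{\varepsilon q}{\beta}\\ \frac{\delta q}{\beta},\frac{fq}{\beta}\end{matrix};q,t\right)\\ &\quad+\left(1-\frac q\beta\right)\frac{(\varepsilon,\gamma,t,\delta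 q/\beta,fq/\beta;q)_\infty}{(f,\delta,\alpha t/\beta,\gamma q/\beta,\varepsilon q/\beta;q)_\infty}\;{}_3\phi_2\left(\begin{matrix}\frac{\alpha q}{\beta},\frac{\gamma q}{\beta},\frac{\varepsilon q}{\beta}\\ \frac{\delta q}{\beta},\frac{fq}{\beta}\end{matrix};q,t\right)\left({}_2\phi_1\left(\begin{matrix}q,\frac qt\\ \frac{\beta q}{\alpha t}\end{matrix};q,\frac q\alpha\right)-1\right)\\ &\quad+\frac{(\varepsilon,\gamma;q)_\infty}{(f,\delta;q)_\infty}\left(1-\frac q\beta\right)\sum_{n=0}^\infty\frac{(t)_n}{(q)_n(\alpha t/\beta)_{n+1}}\left(\frac q\beta\right)^n\sum_{p=0}^n\frac{(\alpha t/\beta)_p}{(t)_p}\left(\frac\beta q\right)^p\sum_{m=0}^n\left[\begin{matrix}n\\m\end{matrix}\right]\left(\frac f\varepsilon\right)_m\varepsilon^m\left(\frac\delta\gamma\right)_{n-m}\gamma^{n-m}. \end{aligned}$$ -/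

import Mathlib

open scoped Topology

/-- The finite `q`-shifted factorial `(a;q)_n = (1 - a)(1 - a q) ⋯ (1 - a q^(n-1))`. -/
noncomputable def qPoch (a q : ℂ) (n : ℕ) : ℂ :=
  ∏ i ∈ Finset.range n, (1 - a * q ^ i)

/-- The infinite `q`-shifted factorial `(a;q)_∞`; for `|q| < 1` it is the limit of `(a;q)_n`,
see `tendsto_qPoch`. -/
noncomputable def qPochInf (a q : ℂ) : ℂ :=
  ∏' i : ℕ, (1 - a * q ^ i)

theorem tendsto_qPoch (a q : ℂ) (hq : ‖q‖ < 1) :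
    Filter.Tendsto (qPoch a q) Filter.atTop (𝓝 (qPochInf a q)) := by
  have hs : Summable fun i : ℕ => ‖-(a * q ^ i)‖ := by
    simp only [norm_neg, norm_mul, norm_pow]
    exact (summable_geometric_of_lt_one (norm_nonneg q) hq).mul_left _
  have h := (multipliable_one_add_of_summable hs).hasProd.tendsto_prod_nat
  simp only [← sub_eq_add_neg] at h
  exact h

/-- `(a₁, …, a_m; q)_n = (a₁;q)_n ⋯ (a_m;q)_n`. -/
noncomputable def qPochs (as : List ℂ) (q : ℂ) (n : ℕ) : ℂ :=
  (as.map fun a => qPoch a q n).prod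

/-- `(a₁, …, a_m; q)_∞ = (a₁;q)_∞ ⋯ (a_m;q)_∞`. -/
noncomputable def qPochInfs (as : List ℂ) (q : ℂ) : ℂ :=
  (as.map fun a => qPochInf a q).prod

/-- The `n`-th term of the basic hypergeometric series with upper parameters `as`, lower
parameters `bs`, base `q` and argument `z` (for `as` one longer than `bs`). -/
noncomputable def basicHypTerm (as bs : List ℂ) (q z : ℂ) (n : ℕ) : ℂ :=
  qPochs as q n / (qPoch q q n * qPochs bs q n) * z ^ n

/-- The basic hypergeometric series `_{r+1}φ_r(as; bs; q, z)`. -/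
noncomputable def basicHyp (as bs : List ℂ) (q z : ℂ) : ℂ :=
  ∑' n : ℕ, basicHypTerm as bs q z n

/-- The Gaussian polynomial. -/
noncomputable def gaussPoly (q : ℂ) (n m : ℕ) : ℂ :=
  if m ≤ n then qPoch q q n / (qPoch q q m * qPoch q q (n - m)) else 0

/-- The `n`-th term of the series
`∑ (α)_n (γ)_n (ε)_n / ((β)_n (δ)_n (f)_n) t^n`. -/
noncomputable def lhsTerm (α β γ δ ε f q t : ℂ) (n : ℕ) : ℂ :=
  qPochs [α, γ, ε] q n / qPochs [β, δ, f] q n * t ^ n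

/-- The `n`-th term of the outer sum of the triple sum. -/
noncomputable def tripleTerm (α β γ δ ε f q t : ℂ) (n : ℕ) : ℂ :=
  qPoch t q n / (qPoch q q n * qPoch (α * t / β) q (n + 1)) * (q / β) ^ n *
    ∑ p ∈ Finset.range (n + 1),
      qPoch (α * t / β) q p / qPoch t q p * (β / q) ^ p *
        ∑ m ∈ Finset.range (n + 1),
          gaussPoly q n m * qPoch (f / ε) q m * ε ^ m *
            qPoch (δ / γ) q (n - m) * γ ^ (n - m)

/-!
Write `F(z) = (δz)_∞ (fz)_∞ / ((γz)_∞ (εz)_∞) = ∑ A n z^n`. By the `q`-binomial theorem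
(`ratioSeries_self`) the innermost sum of the triple sum is `(q)_n A n`. Since
`(γ)_k (ε)_k / ((δ)_k (f)_k)` is a constant times `F(q^k)`, expanding `F` turns the left-hand
series into `∑ A n S(t q^n)`, where `S(t) = ∑ (α)_k/(β)_k t^k`. The function `S` satisfies a
first-order inhomogeneous `q`-difference equation, whose `n`-fold iterate (`ratioSeries_mul_pow`)
expresses `S(t q^n)` as `v n = (q/β)^n (t)_n / (αt/β)_{n+1}` times a constant `C`, plus
`1 - q/β` times the part of the triple sum that runs over `p`. So the left-hand series splits into
the triple sum and `C ∑ A n v n`. Expanding `v n` by the `q`-binomial theorem and summing over `n`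
first turns `∑ A n v n` into the `₃φ₂` series.

The constant is `C = (1 - αt/β) S(t) - (1 - q/β)`, and `S(t)` is evaluated by the three-term
relation `ratioSeries_connection`, which is Ramanujan's `₁ψ₁` sum with the half over the negative
indices continued analytically. As in the classical proof of that sum, both sides satisfy the same
first-order recurrence under `β ↦ βq`, and they agree at `β = q`, where the relation reduces to
the `q`-binomial theorem (`bilateralSum_eq`).

The splitting above needs `A n` and `A n (q/β)^n` to be summable, whereas the theorem assumes only
the summability of the triple sum, that is of the combination `A n (S(t q^n) - C v n)`. When
`|q/β| = 1` both parts of the combination have the same order of magnitude and may partly cancel,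
so the summability of `A n` cannot simply be read off. Therefore `z^n` is inserted, denominators
are cleared, the identity is obtained for small `z` by interchange of summations, and then
transported to `z = 1` by the identity theorem in the unit disc and continuity on its closure
(`tsum_quotCoeff_combination`). Clearing denominators also covers the case where `(γ)_∞ (ε)_∞`
vanishes.
-/

/-! ### Shifted factorials -/

@[simp] theorem qPoch_zero (a q : ℂ) : qPoch a q 0 = 1 := by simp [qPoch]

theorem qPoch_succ (a q : ℂ) (n : ℕ) : qPoch a q (n + 1) = qPoch a q n * (1 - a * q ^ n) :=
  Finset.prod_range_succ _ _

theorem qPoch_add (a q : ℂ) (m n : ℕ) :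
    qPoch a q (m + n) = qPoch a q m * qPoch (a * q ^ m) q n := by
  simp only [qPoch, Finset.prod_range_add]
  congr 1
  exact Finset.prod_congr rfl fun i _ => by ring

theorem qPoch_succ' (a q : ℂ) (n : ℕ) :
    qPoch a q (n + 1) = (1 - a) * qPoch (a * q) q n := by
  rw [add_comm, qPoch_add]
  simp [qPoch]

theorem qPoch_ne_zero {a q : ℂ} (h : ∀ j : ℕ, 1 - a * q ^ j ≠ 0) (n : ℕ) : qPoch a q n ≠ 0 :=
  Finset.prod_ne_zero_iff.2 fun i _ => h i

theorem qPochInf_eq_mul {q : ℂ} (hq : ‖q‖ < 1) (a : ℂ) (n : ℕ) :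
    qPochInf a q = qPoch a q n * qPochInf (a * q ^ n) q := by
  have h₁ := (tendsto_qPoch a q hq).comp (Filter.tendsto_add_atTop_nat n)
  have h₂ := (tendsto_qPoch (a * q ^ n) q hq).const_mul (qPoch a q n)
  refine tendsto_nhds_unique h₁ (h₂.congr fun k => ?_)
  simp [← qPoch_add, add_comm]

theorem qPochInf_eq_mul_one {q : ℂ} (hq : ‖q‖ < 1) (a : ℂ) :
    qPochInf a q = (1 - a) * qPochInf (a * q) q := by
  simpa [qPoch] using qPochInf_eq_mul hq a 1

theorem qPochInf_ne_zero {a q : ℂ} (hq : ‖q‖ < 1) (h : ∀ j : ℕ, 1 - a * q ^ j ≠ 0) :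
    qPochInf a q ≠ 0 := by
  have := tprod_one_add_ne_zero_of_summable (f := fun i : ℕ => -(a * q ^ i))
    (fun i => by simpa [← sub_eq_add_neg] using h i) (by
      simp only [norm_neg, norm_mul, norm_pow]
      exact (summable_geometric_of_lt_one (norm_nonneg q) hq).mul_left _)
  simpa [qPochInf, ← sub_eq_add_neg] using this

/-- A bound for `(a;q)_n` that is uniform in `n` and locally uniform in `a`. -/
theorem norm_qPoch_le {q : ℂ} (hq : ‖q‖ < 1) (a : ℂ) (n : ℕ) :
    ‖qPoch a q n‖ ≤ Real.exp (‖a‖ * (1 - ‖q‖)⁻¹) := by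
  calc ‖qPoch a q n‖ = ∏ i ∈ Finset.range n, ‖1 - a * q ^ i‖ := by simp [qPoch]
    _ ≤ ∏ i ∈ Finset.range n, Real.exp (‖a‖ * ‖q‖ ^ i) := by
        refine Finset.prod_le_prod (fun _ _ => norm_nonneg _) fun i _ => ?_
        calc ‖1 - a * q ^ i‖ ≤ ‖(1 : ℂ)‖ + ‖a * q ^ i‖ := norm_sub_le _ _
          _ = ‖a‖ * ‖q‖ ^ i + 1 := by simp [add_comm]
          _ ≤ _ := Real.add_one_le_exp _
    _ = Real.exp (∑ i ∈ Finset.range n, ‖a‖ * ‖q‖ ^ i) := (Real.exp_sum _ _).symm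
    _ ≤ _ := by
        rw [← Finset.mul_sum]
        gcongr
        rw [← tsum_geometric_of_lt_one (norm_nonneg q) hq]
        exact (summable_geometric_of_lt_one (norm_nonneg q) hq).sum_le_tsum _
          fun i _ => by positivity

theorem norm_qPochInf_le {q : ℂ} (hq : ‖q‖ < 1) (a : ℂ) :
    ‖qPochInf a q‖ ≤ Real.exp (‖a‖ * (1 - ‖q‖)⁻¹) :=
  le_of_tendsto (tendsto_qPoch a q hq).norm (Filter.Eventually.of_forall (norm_qPoch_le hq a))

theorem exists_norm_inv_qPoch_le {a q : ℂ} (hq : ‖q‖ < 1) (h : ∀ j : ℕ, 1 - a * q ^ j ≠ 0) :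
    ∃ M : ℝ, 0 ≤ M ∧ ∀ n, ‖(qPoch a q n)⁻¹‖ ≤ M := by
  have := ((tendsto_qPoch a q hq).inv₀ (qPochInf_ne_zero hq h)).norm.bddAbove_range
  obtain ⟨M, hM⟩ := this
  have hM' : ∀ n, ‖(qPoch a q n)⁻¹‖ ≤ M := fun n => hM ⟨n, rfl⟩
  exact ⟨M, (norm_nonneg _).trans (hM' 0), hM'⟩

theorem differentiable_qPoch (q : ℂ) (n : ℕ) : Differentiable ℂ fun a => qPoch a q n := by
  unfold qPoch
  fun_prop

/-- `(a;q)_∞` is an entire function of `a`: the finite products converge locally uniformly. -/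
theorem differentiable_qPochInf {q : ℂ} (hq : ‖q‖ < 1) :
    Differentiable ℂ fun a => qPochInf a q := by
  intro a
  have hU : IsOpen (Metric.ball (0 : ℂ) (‖a‖ + 1)) := Metric.isOpen_ball
  have h := Summable.hasProdLocallyUniformlyOn_nat_one_add hU
    (f := fun (i : ℕ) (x : ℂ) => -(x * q ^ i)) (u := fun i => (‖a‖ + 1) * ‖q‖ ^ i)
    ((summable_geometric_of_lt_one (norm_nonneg q) hq).mul_left _)
    (Filter.Eventually.of_forall fun i x hx => by
      simp only [norm_neg, norm_mul, norm_pow]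
      gcongr
      simpa using (mem_ball_zero_iff.1 hx).le)
    (fun i => by fun_prop)
  have h' := h.differentiableOn (Filter.Eventually.of_forall fun s => by
    simpa [Finset.prod_fn] using DifferentiableOn.finsetProd (fun _ _ => by fun_prop)) hU
  have := h'.differentiableAt (hU.mem_nhds (by simp : a ∈ Metric.ball (0 : ℂ) (‖a‖ + 1)))
  simpa [qPochInf, ← sub_eq_add_neg] using this

theorem tendsto_mul_pow_zero {q : ℂ} (hq : ‖q‖ < 1) (a : ℂ) :
    Filter.Tendsto (fun n : ℕ => a * q ^ n) Filter.atTop (𝓝 0) := by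
  simpa using (tendsto_pow_atTop_nhds_zero_of_norm_lt_one hq).const_mul a

theorem qPochInf_zero (q : ℂ) : qPochInf 0 q = 1 := by simp [qPochInf]

theorem one_sub_mul_pow_ne_zero {a q : ℂ} (h : ∀ j : ℕ, a ≠ q ^ (-(j : ℤ)))
    (j : ℕ) : 1 - a * q ^ j ≠ 0 := by
  intro h0
  apply h j
  rw [zpow_neg, zpow_natCast]
  exact eq_inv_of_mul_eq_one_left (by linear_combination -h0)

theorem one_sub_mul_pow_ne_zero_of_norm_lt_one {a q : ℂ} (ha : ‖a‖ < 1) (hq : ‖q‖ < 1) (j : ℕ) :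
    1 - a * q ^ j ≠ 0 := by
  intro h0
  have h1 : ‖a * q ^ j‖ < 1 := by
    rw [norm_mul, norm_pow]
    exact mul_lt_one_of_nonneg_of_lt_one_left (norm_nonneg _) ha
      (pow_le_one₀ (norm_nonneg _) hq.le)
  rw [← sub_eq_zero.1 h0] at h1
  simp at h1

theorem one_sub_mul_mul_pow_ne_zero {a q : ℂ} (h : ∀ j : ℕ, 1 - a * q ^ j ≠ 0) (n j : ℕ) :
    1 - a * q ^ n * q ^ j ≠ 0 := by
  rw [mul_assoc, ← pow_add]
  exact h _

/-! ### The series `∑ (α)_n / (β)_n t^n` -/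

theorem tsum_sub_succ {e : ℕ → ℂ} (he : Summable e) : ∑' n, (e n - e (n + 1)) = e 0 := by
  rw [he.tsum_sub ((summable_nat_add_iff 1).2 he), he.tsum_eq_zero_add]
  ring

theorem exists_norm_qPoch_div_le {β q : ℂ} (hq : ‖q‖ < 1) (α : ℂ)
    (hβ : ∀ j : ℕ, 1 - β * q ^ j ≠ 0) :
    ∃ M : ℝ, 0 ≤ M ∧ ∀ n, ‖qPoch α q n / qPoch β q n‖ ≤ M := by
  obtain ⟨M, hM0, hM⟩ := exists_norm_inv_qPoch_le hq hβ
  refine ⟨Real.exp (‖α‖ * (1 - ‖q‖)⁻¹) * M, by positivity, fun n => ?_⟩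
  rw [div_eq_mul_inv, norm_mul]
  exact mul_le_mul (norm_qPoch_le hq _ _) (hM n) (norm_nonneg _) (Real.exp_pos _).le

theorem summable_norm_of_norm_le_mul_pow {a : ℕ → ℂ} {t : ℂ} {M : ℝ} (ht : ‖t‖ < 1)
    (ha : ∀ n, ‖a n‖ ≤ M) : Summable fun n => ‖a n * t ^ n‖ := by
  refine Summable.of_nonneg_of_le (fun _ => norm_nonneg _) (fun n => ?_)
    ((summable_geometric_of_lt_one (norm_nonneg t) ht).mul_left M)
  rw [norm_mul, norm_pow]
  gcongr
  exact ha n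

theorem summable_norm_qPoch_div {β q t : ℂ} (hq : ‖q‖ < 1) (ht : ‖t‖ < 1) (α : ℂ)
    (hβ : ∀ j : ℕ, 1 - β * q ^ j ≠ 0) :
    Summable fun n => ‖qPoch α q n / qPoch β q n * t ^ n‖ := by
  obtain ⟨M, -, hM⟩ := exists_norm_qPoch_div_le hq α hβ
  exact summable_norm_of_norm_le_mul_pow ht hM

/-- The series `∑ (α)_n / (β)_n t^n`, that is `₂φ₁(α, q; β; q, t)`. -/
noncomputable def ratioSeries (α β q t : ℂ) : ℂ :=
  ∑' n : ℕ, qPoch α q n / qPoch β q n * t ^ n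

/-- The first-order `q`-difference equation of `ratioSeries` in its argument. -/
theorem ratioSeries_qdiff {β q t : ℂ} (hq : ‖q‖ < 1) (ht : ‖t‖ < 1) (α : ℂ)
    (hβ : ∀ j : ℕ, 1 - β * q ^ j ≠ 0) :
    q * (1 - t) * ratioSeries α β q t =
      (q - β) + (β - α * t * q) * ratioSeries α β q (t * q) := by
  have htq : ‖t * q‖ < 1 := by
    rw [norm_mul]; exact mul_lt_one_of_nonneg_of_lt_one_left (norm_nonneg _) ht hq.le
  have h₁ : Summable fun n => qPoch α q n / qPoch β q n * t ^ n :=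
    (summable_norm_qPoch_div hq ht α hβ).of_norm
  have h₂ : Summable fun n => qPoch α q n / qPoch β q n * (t * q) ^ n :=
    (summable_norm_qPoch_div hq htq α hβ).of_norm
  have h₃ : Summable fun n => qPoch α q n / qPoch β q n * t ^ n * (q - β * q ^ n) :=
    ((h₁.mul_left q).sub (h₂.mul_left β)).congr fun n => by ring
  have h₄ := tsum_sub_succ h₃
  have h₅ : ∀ n, qPoch α q n / qPoch β q n * t ^ n * (q - β * q ^ n) -
        qPoch α q (n + 1) / qPoch β q (n + 1) * t ^ (n + 1) * (q - β * q ^ (n + 1)) =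
      q * (1 - t) * (qPoch α q n / qPoch β q n * t ^ n) -
        (β - α * t * q) * (qPoch α q n / qPoch β q n * (t * q) ^ n) := fun n => by
    have hn := qPoch_ne_zero hβ n
    have hn' := hβ n
    rw [qPoch_succ, qPoch_succ]
    field_simp
    ring
  rw [tsum_congr h₅, (h₁.mul_left _).tsum_sub (h₂.mul_left _), tsum_mul_left, tsum_mul_left] at h₄
  simp only [qPoch_zero, pow_zero] at h₄
  rw [ratioSeries, ratioSeries]
  linear_combination h₄

theorem norm_mul_pow_lt_one {q t : ℂ} (hq : ‖q‖ < 1) (ht : ‖t‖ < 1) (n : ℕ) :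
    ‖t * q ^ n‖ < 1 := by
  rw [norm_mul, norm_pow]
  exact mul_lt_one_of_nonneg_of_lt_one_left (norm_nonneg _) ht (pow_le_one₀ (norm_nonneg _) hq.le)

/-- The `q`-difference equation iterated `n` times. -/
theorem ratioSeries_mul_pow {α β q t : ℂ} (hq0 : q ≠ 0) (hq : ‖q‖ < 1) (ht : ‖t‖ < 1)
    (hβ0 : β ≠ 0) (hβ : ∀ j : ℕ, 1 - β * q ^ j ≠ 0)
    (hx : ∀ j : ℕ, 1 - α * t / β * q ^ j ≠ 0) (n : ℕ) :
    ratioSeries α β q (t * q ^ n) =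
      (q / β) ^ n * qPoch t q n / qPoch (α * t / β) q (n + 1) *
        ((1 - α * t / β) * ratioSeries α β q t - (1 - q / β) + (1 - q / β) *
          ∑ p ∈ Finset.range (n + 1), qPoch (α * t / β) q p / qPoch t q p * (β / q) ^ p) := by
  have htj := one_sub_mul_pow_ne_zero_of_norm_lt_one ht hq
  induction n with
  | zero =>
    have := hx 0
    simp only [pow_zero, mul_one] at this
    simp only [zero_add, qPoch_succ, qPoch_zero, pow_zero, mul_one, one_mul, div_one,
      Finset.sum_range_one, sub_add_cancel]
    generalize 1 - α * t / β = a at *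
    field_simp
  | succ n ih =>
    have h := ratioSeries_qdiff hq (norm_mul_pow_lt_one hq ht n) α hβ
    have hn := qPoch_ne_zero htj n
    have hx1 := qPoch_ne_zero hx (n + 1)
    have h1 := hx (n + 1)
    have h2 := htj n
    have h3 : β - α * (t * q ^ n) * q ≠ 0 := by
      intro h0
      apply h1
      field_simp
      linear_combination h0
    have h4 : ratioSeries α β q (t * q ^ (n + 1)) =
        (q * (1 - t * q ^ n) * ratioSeries α β q (t * q ^ n) - (q - β)) /
          (β - α * (t * q ^ n) * q) := by
      rw [eq_div_iff h3, h, pow_succ, ← mul_assoc t]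
      ring
    have h5 : β - α * (t * q ^ n) * q = β * (1 - α * t / β * q ^ (n + 1)) := by
      field_simp
      ring
    rw [h4, ih, Finset.sum_range_succ _ (n + 1), qPoch_succ (α * t / β) q (n + 1),
      qPoch_succ t q n, h5]
    generalize ∑ p ∈ Finset.range (n + 1), qPoch (α * t / β) q p / qPoch t q p * (β / q) ^ p = s
    generalize 1 - α * t / β * q ^ (n + 1) = a at *
    generalize 1 - t * q ^ n = b at *
    generalize qPoch (α * t / β) q (n + 1) = c at *
    generalize qPoch t q n = d at *
    generalize ratioSeries α β q t = e at *
    simp only [div_pow, pow_succ]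
    field_simp
    ring

theorem tendsto_ratioSeries_mul_pow {β q t : ℂ} (hq : ‖q‖ < 1) (ht : ‖t‖ < 1) (α : ℂ)
    (hβ : ∀ j : ℕ, 1 - β * q ^ j ≠ 0) :
    Filter.Tendsto (fun n : ℕ => ratioSeries α β q (t * q ^ n)) Filter.atTop (𝓝 1) := by
  have h := tendsto_tsum_of_dominated_convergence (𝓕 := Filter.atTop)
    (f := fun (n k : ℕ) => qPoch α q k / qPoch β q k * (t * q ^ n) ^ k)
    (g := fun k : ℕ => if k = 0 then (1 : ℂ) else 0)
    (summable_norm_qPoch_div hq ht α hβ) (fun k => by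
      rcases eq_or_ne k 0 with rfl | hk
      · simp
      · have := ((tendsto_mul_pow_zero hq t).pow k).const_mul (qPoch α q k / qPoch β q k)
        simpa [hk] using this)
    (Filter.Eventually.of_forall fun n k => by
      rw [norm_mul, norm_mul, norm_pow, norm_pow, norm_mul, norm_pow]
      gcongr
      exact mul_le_of_le_one_right (norm_nonneg _) (pow_le_one₀ (norm_nonneg _) hq.le))
  simpa [ratioSeries] using h

/-- The `q`-binomial theorem. -/
theorem ratioSeries_self {q t : ℂ} (hq : ‖q‖ < 1) (hq0 : q ≠ 0) (ht : ‖t‖ < 1) (α : ℂ) :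
    ratioSeries α q q t = qPochInf (α * t) q / qPochInf t q := by
  have hqj := one_sub_mul_pow_ne_zero_of_norm_lt_one hq hq
  have htj := one_sub_mul_pow_ne_zero_of_norm_lt_one ht hq
  have hn : ∀ n, qPoch t q n * ratioSeries α q q t =
      qPoch (α * t) q n * ratioSeries α q q (t * q ^ n) := fun n => by
    induction n with
    | zero => simp
    | succ n ih =>
      have h := ratioSeries_qdiff hq (norm_mul_pow_lt_one hq ht n) α hqj
      rw [mul_assoc t, ← pow_succ] at h
      have h' : (1 - t * q ^ n) * ratioSeries α q q (t * q ^ n) =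
          (1 - α * t * q ^ n) * ratioSeries α q q (t * q ^ (n + 1)) :=
        mul_left_cancel₀ hq0 (by linear_combination h)
      rw [qPoch_succ, qPoch_succ]
      linear_combination (1 - t * q ^ n) * ih + qPoch (α * t) q n * h'
  rw [eq_div_iff (qPochInf_ne_zero hq htj), mul_comm]
  have h₁ := (tendsto_qPoch t q hq).mul_const (ratioSeries α q q t)
  have h₂ := (tendsto_qPoch (α * t) q hq).mul (tendsto_ratioSeries_mul_pow hq ht α hqj)
  rw [mul_one] at h₂
  exact tendsto_nhds_unique h₁ (h₂.congr fun n => (hn n).symm)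

/-! ### Continuation of Ramanujan's bilateral sum -/

/-- With `w n = (q/t)_n (q/α)^n`, the combination
`(β/(αt))_∞ ∑ (α)_n/(β)_n t^n - (q-β)/(αt) ∑ w n (β q^(n+1)/(αt))_∞`.
Its value is a product; this is Ramanujan's `₁ψ₁` sum, with the half over negative indices
replaced by its analytic continuation in `β` and all poles cleared. -/
noncomputable def bilateralSum (α q t : ℂ) (w : ℕ → ℂ) (β : ℂ) : ℂ :=
  qPochInf (β / (α * t)) q * ratioSeries α β q t -
    (q - β) / (α * t) * ∑' n, w n * qPochInf (β * q / (α * t) * q ^ n) q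

theorem summable_mul_qPochInf {q : ℂ} (hq : ‖q‖ < 1) {w : ℕ → ℂ}
    (hw : Summable fun n => ‖w n‖) (y : ℂ) :
    Summable fun n => w n * qPochInf (y * q ^ n) q := by
  refine Summable.of_norm_bounded (hw.mul_right (Real.exp (‖y‖ * (1 - ‖q‖)⁻¹))) fun n => ?_
  rw [norm_mul]
  gcongr
  refine (norm_qPochInf_le hq _).trans ?_
  have : 0 < 1 - ‖q‖ := by linarith
  gcongr
  rw [norm_mul, norm_pow]
  exact mul_le_of_le_one_right (norm_nonneg _) (pow_le_one₀ (norm_nonneg _) hq.le)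

/-- The contiguous relation under `β ↦ βq`. -/
theorem ratioSeries_lower {α β q t : ℂ} (hq : ‖q‖ < 1) (ht : ‖t‖ < 1) (ht0 : t ≠ 0)
    (hα0 : α ≠ 0) (hβ : ∀ j : ℕ, 1 - β * q ^ j ≠ 0) :
    (1 - β / α) * ratioSeries α (β * q) q t =
      (1 - β) * ((1 - β / (α * t)) * ratioSeries α β q t + β / (α * t)) := by
  have hβq : ∀ j : ℕ, 1 - β * q * q ^ j ≠ 0 := by
    simpa using one_sub_mul_mul_pow_ne_zero hβ 1
  have h₁ : Summable fun n => qPoch α q n / qPoch β q n * t ^ n :=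
    (summable_norm_qPoch_div hq ht α hβ).of_norm
  have h₂ := h₁.tsum_eq_zero_add
  have h₃ : ∀ n, (1 - β / α) * (qPoch α q n / qPoch (β * q) q n * t ^ n) =
      (1 - β) * (qPoch α q n / qPoch β q n * t ^ n -
        β / (α * t) * (qPoch α q (n + 1) / qPoch β q (n + 1) * t ^ (n + 1))) := fun n => by
    have hb := hβ 0
    have hn := qPoch_ne_zero hβq n
    have hn1 := qPoch_ne_zero hβ n
    have hn' := hβ n
    rw [pow_zero, mul_one] at hb
    have e : qPoch (β * q) q n = qPoch β q n * (1 - β * q ^ n) / (1 - β) := by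
      rw [eq_div_iff hb, ← qPoch_succ, qPoch_succ', mul_comm]
    rw [e, qPoch_succ, qPoch_succ]
    field_simp
    ring
  rw [ratioSeries, ← tsum_mul_left, tsum_congr h₃, tsum_mul_left,
    h₁.tsum_sub (((summable_nat_add_iff 1).2 h₁).mul_left _), tsum_mul_left, ratioSeries]
  simp only [qPoch_zero, pow_zero] at h₂
  linear_combination (1 - β) * β / (α * t) * h₂

/-- The inhomogeneous terms of the recurrences of the two series under `β ↦ βq` cancel. -/
theorem bilateralSum_step {α β q t : ℂ} (hq : ‖q‖ < 1) (ht : ‖t‖ < 1) (ht0 : t ≠ 0)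
    (hα0 : α ≠ 0) (hβ : ∀ j : ℕ, 1 - β * q ^ j ≠ 0) {w : ℕ → ℂ}
    (hw : Summable fun n => ‖w n‖) (hw0 : w 0 = 1)
    (hws : ∀ n, w (n + 1) = w n * ((1 - q / t * q ^ n) * (q / α))) :
    (1 - β) * bilateralSum α q t w β = (1 - β / α) * bilateralSum α q t w (β * q) := by
  set y := β * q / (α * t) with hy
  have hP : ∀ n : ℕ, qPochInf (y * q ^ n) q = (1 - y * q ^ n) * qPochInf (y * q * q ^ n) q :=
    fun n => by rw [qPochInf_eq_mul_one hq (y * q ^ n)]; ring_nf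
  have s₁ := summable_mul_qPochInf hq hw y
  have s₂ := summable_mul_qPochInf hq hw (y * q)
  have h₁ := tsum_sub_succ s₁
  -- The summands of the recurrence for the second series telescope, because
  -- `β * w (n + 1) = w n * (β * q / α - y * q ^ (n + 1))`.
  have h₂ : ∀ n, (q - β) * (w n * qPochInf (y * q ^ n) q) -
        (q - β * q / α) * (w n * qPochInf (y * q * q ^ n) q) =
      -β * (w n * qPochInf (y * q ^ n) q - w (n + 1) * qPochInf (y * q ^ (n + 1)) q) := fun n => by
    rw [hws, show y * q ^ (n + 1) = y * q * q ^ n by ring, hP n, hy]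
    field_simp
    ring
  have h₃ := tsum_congr (L := .unconditional ℕ) h₂
  rw [tsum_mul_left, h₁, (s₁.mul_left _).tsum_sub (s₂.mul_left _), tsum_mul_left,
    tsum_mul_left, hw0] at h₃
  simp only [pow_zero, mul_one, one_mul] at h₃
  have h₄ := ratioSeries_lower hq ht ht0 hα0 hβ
  have e₁ : qPochInf (β / (α * t)) q = (1 - β / (α * t)) * qPochInf y q := by
    rw [qPochInf_eq_mul_one hq, hy]; ring_nf
  have e₂ : β * q * q / (α * t) = y * q := by rw [hy]; ring
  rw [bilateralSum, bilateralSum, ← hy, e₂, e₁]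
  linear_combination -qPochInf y q * h₄ - (1 - β) / (α * t) * h₃

theorem bilateralSum_iterate {α β q t : ℂ} (hq : ‖q‖ < 1) (ht : ‖t‖ < 1) (ht0 : t ≠ 0)
    (hα0 : α ≠ 0) (hβ : ∀ j : ℕ, 1 - β * q ^ j ≠ 0) {w : ℕ → ℂ}
    (hw : Summable fun n => ‖w n‖) (hw0 : w 0 = 1)
    (hws : ∀ n, w (n + 1) = w n * ((1 - q / t * q ^ n) * (q / α))) (n : ℕ) :
    qPoch β q n * bilateralSum α q t w β =
      qPoch (β / α) q n * bilateralSum α q t w (β * q ^ n) := by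
  induction n with
  | zero => simp
  | succ n ih =>
    have h := bilateralSum_step hq ht ht0 hα0 (one_sub_mul_mul_pow_ne_zero hβ n) hw hw0 hws
    rw [mul_assoc β, ← pow_succ] at h
    rw [qPoch_succ, qPoch_succ]
    linear_combination (1 - β * q ^ n) * ih + qPoch (β / α) q n * h

/-- The limit of `bilateralSum` along `β q^n` does not depend on `β`. -/
theorem tendsto_bilateralSum {α β q t : ℂ} (hq : ‖q‖ < 1) (ht : ‖t‖ < 1)
    (hβ : ∀ j : ℕ, 1 - β * q ^ j ≠ 0) {w : ℕ → ℂ} (hw : Summable fun n => ‖w n‖) :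
    Filter.Tendsto (fun n : ℕ => bilateralSum α q t w (β * q ^ n)) Filter.atTop
      (𝓝 (∑' n, qPoch α q n * t ^ n - q / (α * t) * ∑' n, w n)) := by
  have hcont := (differentiable_qPochInf hq).continuous
  have hlim := tendsto_mul_pow_zero hq β
  have c₁ : Filter.Tendsto (fun n : ℕ => qPochInf (β * q ^ n / (α * t)) q) Filter.atTop
      (𝓝 1) := by
    have := hcont.tendsto 0
    rw [qPochInf_zero] at this
    exact this.comp (by simpa using hlim.div_const (α * t))
  have c₂ : Filter.Tendsto (fun n : ℕ => (q - β * q ^ n) / (α * t)) Filter.atTop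
      (𝓝 (q / (α * t))) := by
    simpa using (hlim.const_sub q).div_const (α * t)
  obtain ⟨M, hM0, hM⟩ := exists_norm_inv_qPoch_le hq hβ
  have c₃ : Filter.Tendsto (fun n : ℕ => ratioSeries α (β * q ^ n) q t) Filter.atTop
      (𝓝 (∑' k, qPoch α q k * t ^ k)) := by
    refine tendsto_tsum_of_dominated_convergence (bound := fun k =>
      Real.exp (‖α‖ * (1 - ‖q‖)⁻¹) * (M * Real.exp (‖β‖ * (1 - ‖q‖)⁻¹)) * ‖t‖ ^ k)
      ((summable_geometric_of_lt_one (norm_nonneg t) ht).mul_left _) (fun k => ?_)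
      (Filter.Eventually.of_forall fun n k => ?_)
    · have := (differentiable_qPoch q k).continuous.tendsto 0
      have := (this.comp hlim).inv₀ (by simp [qPoch])
      have := (this.const_mul (qPoch α q k)).mul_const (t ^ k)
      simpa [qPoch, div_eq_mul_inv] using this
    · have e : (qPoch (β * q ^ n) q k)⁻¹ = (qPoch β q (n + k))⁻¹ * qPoch β q n := by
        have := qPoch_ne_zero hβ n
        rw [qPoch_add]
        field_simp
      rw [div_eq_mul_inv, e, norm_mul, norm_mul, norm_mul, norm_pow]
      gcongr
      · exact norm_qPoch_le hq _ _
      · exact hM _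
      · exact norm_qPoch_le hq _ _
  have c₄ : Filter.Tendsto
      (fun n : ℕ => ∑' k, w k * qPochInf (β * q ^ n * q / (α * t) * q ^ k) q) Filter.atTop
      (𝓝 (∑' k, w k)) := by
    refine tendsto_tsum_of_dominated_convergence (bound := fun k =>
      ‖w k‖ * Real.exp (‖β * q / (α * t)‖ * (1 - ‖q‖)⁻¹)) (hw.mul_right _) (fun k => ?_)
      (Filter.Eventually.of_forall fun n k => ?_)
    · have h0 := hcont.tendsto 0
      rw [qPochInf_zero] at h0
      have h1 := ((hlim.mul_const q).div_const (α * t)).mul_const (q ^ k)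
      simp only [zero_mul, zero_div] at h1
      simpa using (h0.comp h1).const_mul (w k)
    · rw [norm_mul]
      gcongr
      refine (norm_qPochInf_le hq _).trans ?_
      have : 0 < 1 - ‖q‖ := by linarith
      gcongr
      rw [show β * q ^ n * q / (α * t) * q ^ k = β * q / (α * t) * q ^ (n + k) by ring,
        norm_mul, norm_pow]
      exact mul_le_of_le_one_right (norm_nonneg _) (pow_le_one₀ (norm_nonneg _) hq.le)
  have := (c₁.mul c₃).sub (c₂.mul c₄)
  rw [one_mul] at this
  exact this

/-- At `β = q` the second series drops out and the first is summed by the `q`-binomial theorem,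
which determines the common limit of `bilateralSum` along `β q^n`. -/
theorem bilateralSum_eq {α β q t : ℂ} (hq0 : q ≠ 0) (hq : ‖q‖ < 1) (ht : ‖t‖ < 1) (ht0 : t ≠ 0)
    (hα0 : α ≠ 0) (hβ : ∀ j : ℕ, 1 - β * q ^ j ≠ 0) (hα : ∀ j : ℕ, 1 - q / α * q ^ j ≠ 0)
    {w : ℕ → ℂ} (hw : Summable fun n => ‖w n‖) (hw0 : w 0 = 1)
    (hws : ∀ n, w (n + 1) = w n * ((1 - q / t * q ^ n) * (q / α))) :
    bilateralSum α q t w β = qPochInf (β / α) q * qPochInf q q * qPochInf (α * t) q *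
      qPochInf (q / (α * t)) q / (qPochInf β q * qPochInf (q / α) q * qPochInf t q) := by
  have key : ∀ b : ℂ, (∀ j : ℕ, 1 - b * q ^ j ≠ 0) →
      qPochInf b q * bilateralSum α q t w b = qPochInf (b / α) q *
        (∑' n, qPoch α q n * t ^ n - q / (α * t) * ∑' n, w n) := fun b hb =>
    tendsto_nhds_unique ((tendsto_qPoch b q hq).mul_const _)
      (((tendsto_qPoch (b / α) q hq).mul (tendsto_bilateralSum hq ht hb hw)).congr fun n =>
        (bilateralSum_iterate hq ht ht0 hα0 hb hw hw0 hws n).symm)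
  have hqj := one_sub_mul_pow_ne_zero_of_norm_lt_one hq hq
  have hβ' := key β hβ
  have hq' := key q hqj
  rw [bilateralSum, sub_self, zero_div, zero_mul, sub_zero, ratioSeries_self hq hq0 ht] at hq'
  have n₁ := qPochInf_ne_zero hq hβ
  have n₂ := qPochInf_ne_zero hq hα
  have n₃ := qPochInf_ne_zero hq (one_sub_mul_pow_ne_zero_of_norm_lt_one ht hq)
  generalize ∑' n, qPoch α q n * t ^ n - q / (α * t) * ∑' n, w n = L at *
  generalize bilateralSum α q t w β = R at *
  field_simp at hq' ⊢
  linear_combination qPochInf (q / α) q * qPochInf t q * hβ' - qPochInf (β / α) q * hq'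

theorem basicHypTerm_two_one {q : ℂ} (hq : ‖q‖ < 1) (t y z : ℂ) (n : ℕ) :
    basicHypTerm [q, t] [y] q z n = qPoch t q n / qPoch y q n * z ^ n := by
  have := qPoch_ne_zero (one_sub_mul_pow_ne_zero_of_norm_lt_one hq hq) n
  simp only [basicHypTerm, qPochs, List.map_cons, List.map_nil, List.prod_cons, List.prod_nil,
    mul_one]
  rw [mul_div_mul_left _ _ this]

/-- The three-term relation between `₂φ₁(α, q; β; q, t)` and
`₂φ₁(q, q/t; βq/(αt); q, q/α)`. Convergence of the latter is assumed rather than `‖q / α‖ < 1`,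
because the series also terminates when `t` is a positive power of `q`. -/
theorem ratioSeries_connection {α β q t : ℂ} (hq0 : q ≠ 0) (hq : ‖q‖ < 1) (ht : ‖t‖ < 1)
    (ht0 : t ≠ 0) (hα0 : α ≠ 0) (hβ0 : β ≠ 0) (hβ : ∀ j : ℕ, 1 - β * q ^ j ≠ 0)
    (hα : ∀ j : ℕ, 1 - q / α * q ^ j ≠ 0) (hy : ∀ j : ℕ, 1 - β / (α * t) * q ^ j ≠ 0)
    (hs : Summable (basicHypTerm [q, q / t] [β * q / (α * t)] q (q / α))) :
    (1 - α * t / β) * ratioSeries α β q t =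
      (1 - q / β) * basicHyp [q, q / t] [β * q / (α * t)] q (q / α) +
      (1 - α * t / β) * (qPochInf (β / α) q * qPochInf q q * qPochInf (α * t) q *
        qPochInf (q / (α * t)) q / (qPochInf β q * qPochInf (q / α) q * qPochInf t q *
          qPochInf (β / (α * t)) q)) := by
  have hyq : ∀ j : ℕ, 1 - β * q / (α * t) * q ^ j ≠ 0 := fun j => by
    have := hy (j + 1)
    rwa [show β / (α * t) * q ^ (j + 1) = β * q / (α * t) * q ^ j by ring] at this
  set w : ℕ → ℂ := fun n => qPoch (q / t) q n * (q / α) ^ n with hwdef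
  have hterm : ∀ n, w n =
      basicHypTerm [q, q / t] [β * q / (α * t)] q (q / α) n * qPoch (β * q / (α * t)) q n :=
    fun n => by
      have := qPoch_ne_zero hyq n
      rw [basicHypTerm_two_one hq, mul_right_comm, div_mul_cancel₀ _ this]
  have hw : Summable fun n => ‖w n‖ := by
    refine Summable.of_nonneg_of_le (fun _ => norm_nonneg _) (fun n => ?_)
      (hs.norm.mul_right (Real.exp (‖β * q / (α * t)‖ * (1 - ‖q‖)⁻¹)))
    rw [hterm, norm_mul]
    gcongr
    exact norm_qPoch_le hq _ _
  have h := bilateralSum_eq hq0 hq ht ht0 hα0 hβ hα hw (by simp [hwdef]) fun n => by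
    simp only [hwdef, qPoch_succ]; ring
  have e₁ : ∑' n, w n * qPochInf (β * q / (α * t) * q ^ n) q =
      basicHyp [q, q / t] [β * q / (α * t)] q (q / α) * qPochInf (β * q / (α * t)) q := by
    rw [basicHyp, ← tsum_mul_right]
    refine tsum_congr fun n => ?_
    rw [hterm, qPochInf_eq_mul hq (β * q / (α * t)) n, mul_assoc]
  have e₂ : qPochInf (β / (α * t)) q =
      (1 - β / (α * t)) * qPochInf (β * q / (α * t)) q := by
    rw [qPochInf_eq_mul_one hq]; ring_nf
  have n₀ := hy 0
  rw [pow_zero, mul_one] at n₀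
  have n₁ := qPochInf_ne_zero hq hβ
  have n₂ := qPochInf_ne_zero hq hα
  have n₃ := qPochInf_ne_zero hq (one_sub_mul_pow_ne_zero_of_norm_lt_one ht hq)
  have n₄ := qPochInf_ne_zero hq hyq
  have e₃ : 1 - α * t / β = -(α * t / β) * (1 - β / (α * t)) := by
    field_simp
    ring
  rw [bilateralSum, e₁, e₂] at h
  rw [e₃, e₂]
  generalize basicHyp [q, q / t] [β * q / (α * t)] q (q / α) = Φ at *
  generalize ratioSeries α β q t = S at *
  generalize qPochInf (β * q / (α * t)) q = Y at *
  rw [show qPochInf (β / α) q * qPochInf q q * qPochInf (α * t) q *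
        qPochInf (q / (α * t)) q / (qPochInf β q * qPochInf (q / α) q * qPochInf t q *
          ((1 - β / (α * t)) * Y)) = (qPochInf (β / α) q * qPochInf q q * qPochInf (α * t) q *
        qPochInf (q / (α * t)) q / (qPochInf β q * qPochInf (q / α) q * qPochInf t q)) /
          ((1 - β / (α * t)) * Y) by rw [div_div], ← h]
  generalize hz : 1 - β / (α * t) = Z at *
  field_simp
  ring

/-! ### The generating function of the inner sums -/

/-- The Taylor coefficients of `(δz)_∞ (fz)_∞ / ((γz)_∞ (εz)_∞)`. -/
noncomputable def quotCoeff (γ δ ε f q : ℂ) (n : ℕ) : ℂ :=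
  ∑ m ∈ Finset.range (n + 1), qPoch (f / ε) q m / qPoch q q m * ε ^ m *
    (qPoch (δ / γ) q (n - m) / qPoch q q (n - m) * γ ^ (n - m))

theorem quotCoeff_mul_pow (γ δ ε f q z : ℂ) (n : ℕ) :
    quotCoeff γ δ ε f q n * z ^ n = ∑ m ∈ Finset.range (n + 1),
      qPoch (f / ε) q m / qPoch q q m * (ε * z) ^ m *
        (qPoch (δ / γ) q (n - m) / qPoch q q (n - m) * (γ * z) ^ (n - m)) := by
  rw [quotCoeff, Finset.sum_mul]
  refine Finset.sum_congr rfl fun m hm => ?_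
  have : z ^ n = z ^ m * z ^ (n - m) := by
    rw [← pow_add, Nat.add_sub_cancel' (Nat.lt_succ_iff.1 (Finset.mem_range.1 hm))]
  rw [this, mul_pow, mul_pow]
  ring

theorem summable_norm_quotCoeff {γ ε q z : ℂ} (hq : ‖q‖ < 1) (δ f : ℂ) (hγ : ‖γ * z‖ < 1)
    (hε : ‖ε * z‖ < 1) : Summable fun n => ‖quotCoeff γ δ ε f q n * z ^ n‖ := by
  have hqj := one_sub_mul_pow_ne_zero_of_norm_lt_one hq hq
  have h₁ := summable_norm_qPoch_div hq hε (f / ε) hqj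
  have h₂ := summable_norm_qPoch_div hq hγ (δ / γ) hqj
  have h := summable_norm_sum_mul_range_of_summable_norm h₁ h₂
  refine h.congr fun n => ?_
  rw [quotCoeff_mul_pow]

/-- Cauchy product of two instances of the `q`-binomial theorem. -/
theorem tsum_quotCoeff {γ ε q z : ℂ} (hq0 : q ≠ 0) (hq : ‖q‖ < 1) (hγ0 : γ ≠ 0) (hε0 : ε ≠ 0)
    (δ f : ℂ) (hγ : ‖γ * z‖ < 1) (hε : ‖ε * z‖ < 1) :
    qPochInf (γ * z) q * qPochInf (ε * z) q * ∑' n, quotCoeff γ δ ε f q n * z ^ n =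
      qPochInf (δ * z) q * qPochInf (f * z) q := by
  have hqj := one_sub_mul_pow_ne_zero_of_norm_lt_one hq hq
  simp only [quotCoeff_mul_pow]
  rw [← tsum_mul_tsum_eq_tsum_sum_range_of_summable_norm
    (summable_norm_qPoch_div hq hε (f / ε) hqj) (summable_norm_qPoch_div hq hγ (δ / γ) hqj)]
  have h₁ := ratioSeries_self hq hq0 hε (f / ε)
  have h₂ := ratioSeries_self hq hq0 hγ (δ / γ)
  rw [ratioSeries, show f / ε * (ε * z) = f * z by field_simp] at h₁
  rw [ratioSeries, show δ / γ * (γ * z) = δ * z by field_simp] at h₂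
  rw [h₁, h₂]
  have n₁ := qPochInf_ne_zero hq (one_sub_mul_pow_ne_zero_of_norm_lt_one hγ hq)
  have n₂ := qPochInf_ne_zero hq (one_sub_mul_pow_ne_zero_of_norm_lt_one hε hq)
  generalize qPochInf (γ * z) q = x at *
  generalize qPochInf (ε * z) q = y at *
  field_simp

/-- The series `∑ a_k F(z q^k)` for `F(z) = (δz)_∞ (fz)_∞ / ((γz)_∞ (εz)_∞)`, multiplied by
`(γz)_∞ (εz)_∞`. Unlike the quotient itself it has no poles. -/
noncomputable def clearedSeries (γ δ ε f q : ℂ) (a : ℕ → ℂ) (z : ℂ) : ℂ :=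
  ∑' k, a k * (qPoch (γ * z) q k * qPoch (ε * z) q k *
    (qPochInf (δ * z * q ^ k) q * qPochInf (f * z * q ^ k) q))

theorem summable_mul_pow_pow {q : ℂ} (hq : ‖q‖ < 1) {a : ℕ → ℂ} (ha : Summable fun k => ‖a k‖)
    (n : ℕ) : Summable fun k => a k * (q ^ k) ^ n := by
  refine Summable.of_norm_bounded ha fun k => ?_
  rw [norm_mul, norm_pow, norm_pow, ← pow_mul]
  exact mul_le_of_le_one_right (norm_nonneg _) (pow_le_one₀ (norm_nonneg _) hq.le)

theorem summable_quotCoeff_mul_tsum {γ ε q z : ℂ} (hq : ‖q‖ < 1) (δ f : ℂ) (hγ : ‖γ * z‖ < 1)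
    (hε : ‖ε * z‖ < 1) {a : ℕ → ℂ} (ha : Summable fun k => ‖a k‖) :
    Summable fun n => quotCoeff γ δ ε f q n * z ^ n * ∑' k, a k * (q ^ k) ^ n := by
  refine Summable.of_norm_bounded
    ((summable_norm_quotCoeff hq δ f hγ hε).mul_right (∑' k, ‖a k‖)) fun n => ?_
  rw [norm_mul]
  gcongr
  refine (norm_tsum_le_tsum_norm (summable_mul_pow_pow hq ha n).norm).trans ?_
  refine (summable_mul_pow_pow hq ha n).norm.tsum_le_tsum (fun k => ?_) ha
  rw [norm_mul, norm_pow, norm_pow, ← pow_mul]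
  exact mul_le_of_le_one_right (norm_nonneg _) (pow_le_one₀ (norm_nonneg _) hq.le)

/-- Interchange of the summations over `n` and `k`, for `z` in the disc of convergence. -/
theorem clearedSeries_eq {γ ε q z : ℂ} (hq0 : q ≠ 0) (hq : ‖q‖ < 1) (hγ0 : γ ≠ 0) (hε0 : ε ≠ 0)
    (δ f : ℂ) (hγ : ‖γ * z‖ < 1) (hε : ‖ε * z‖ < 1) {a : ℕ → ℂ} (ha : Summable fun k => ‖a k‖) :
    qPochInf (γ * z) q * qPochInf (ε * z) q *
        ∑' n, quotCoeff γ δ ε f q n * z ^ n * ∑' k, a k * (q ^ k) ^ n =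
      clearedSeries γ δ ε f q a z := by
  have hA := summable_norm_quotCoeff hq δ f hγ hε
  have hsum : Summable (Function.uncurry fun n k : ℕ =>
      quotCoeff γ δ ε f q n * z ^ n * (a k * (q ^ k) ^ n)) := by
    refine Summable.of_norm_bounded (hA.mul_norm ha) fun ⟨n, k⟩ => ?_
    rw [Function.uncurry_apply_pair, norm_mul, norm_mul _ (a k), norm_mul (a k), norm_pow (q ^ k),
      norm_pow q, ← pow_mul]
    refine mul_le_mul_of_nonneg_left ?_ (norm_nonneg _)
    exact mul_le_of_le_one_right (norm_nonneg _) (pow_le_one₀ (norm_nonneg _) hq.le)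
  have hcomm : ∑' n, quotCoeff γ δ ε f q n * z ^ n * ∑' k, a k * (q ^ k) ^ n =
      ∑' k, ∑' n, quotCoeff γ δ ε f q n * z ^ n * (a k * (q ^ k) ^ n) := by
    simp only [← tsum_mul_left]
    exact hsum.tsum_comm.symm
  rw [hcomm, clearedSeries, ← tsum_mul_left]
  refine tsum_congr fun k => ?_
  have hγk : ‖γ * (z * q ^ k)‖ < 1 := by
    rw [← mul_assoc]; exact norm_mul_pow_lt_one hq hγ k
  have hεk : ‖ε * (z * q ^ k)‖ < 1 := by
    rw [← mul_assoc]; exact norm_mul_pow_lt_one hq hε k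
  have h := tsum_quotCoeff hq0 hq hγ0 hε0 δ f hγk hεk
  simp only [← mul_assoc δ, ← mul_assoc f, ← mul_assoc γ, ← mul_assoc ε] at h
  rw [← h, qPochInf_eq_mul hq (γ * z) k, qPochInf_eq_mul hq (ε * z) k]
  have e : ∑' n, quotCoeff γ δ ε f q n * z ^ n * (a k * (q ^ k) ^ n) =
      a k * ∑' n, quotCoeff γ δ ε f q n * (z * q ^ k) ^ n := by
    rw [← tsum_mul_left]
    exact tsum_congr fun n => by rw [mul_pow]; ring
  rw [e]
  ring

theorem differentiable_clearedSeries {q : ℂ} (hq : ‖q‖ < 1) (γ δ ε f : ℂ) {a : ℕ → ℂ}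
    (ha : Summable fun k => ‖a k‖) : Differentiable ℂ (clearedSeries γ δ ε f q a) := by
  intro z₀
  set R := ‖z₀‖ + 1
  have hpos : 0 < 1 - ‖q‖ := by linarith
  have hd := differentiable_qPochInf hq
  have h : DifferentiableOn ℂ (clearedSeries γ δ ε f q a) (Metric.ball 0 R) := by
    refine Complex.differentiableOn_tsum_of_summable_norm
      (ha.mul_right (Real.exp (‖γ‖ * R * (1 - ‖q‖)⁻¹) * Real.exp (‖ε‖ * R * (1 - ‖q‖)⁻¹) *
        (Real.exp (‖δ‖ * R * (1 - ‖q‖)⁻¹) * Real.exp (‖f‖ * R * (1 - ‖q‖)⁻¹))))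
      (fun k => ?_) Metric.isOpen_ball fun k z hz => ?_
    · have h₁ := (differentiable_qPoch q k).comp (differentiable_id.const_mul γ)
      have h₂ := (differentiable_qPoch q k).comp (differentiable_id.const_mul ε)
      have h₃ := hd.comp ((differentiable_id.const_mul δ).mul_const (q ^ k))
      have h₄ := hd.comp ((differentiable_id.const_mul f).mul_const (q ^ k))
      exact (((h₁.mul h₂).mul (h₃.mul h₄)).const_mul (a k)).differentiableOn
    · have hz' : ‖z‖ ≤ R := (mem_ball_zero_iff.1 hz).le
      have b₁ : ∀ c, ‖qPoch (c * z) q k‖ ≤ Real.exp (‖c‖ * R * (1 - ‖q‖)⁻¹) := fun c => by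
        refine (norm_qPoch_le hq _ k).trans ?_
        rw [norm_mul]
        gcongr
      have b₂ : ∀ c, ‖qPochInf (c * z * q ^ k) q‖ ≤ Real.exp (‖c‖ * R * (1 - ‖q‖)⁻¹) := fun c => by
        refine (norm_qPochInf_le hq _).trans ?_
        gcongr
        rw [norm_mul, norm_mul, norm_pow]
        refine (mul_le_of_le_one_right (by positivity) (pow_le_one₀ (norm_nonneg _) hq.le)).trans ?_
        gcongr
      simp only [norm_mul]
      gcongr
      exacts [b₁ γ, b₁ ε, b₂ δ, b₂ f]
  exact h.differentiableAt (Metric.isOpen_ball.mem_nhds (by simp [R]))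

/-- Summation at `z = 1`, which may lie outside the disc of convergence of `∑ quotCoeff n z^n`.
Only the combination `B n` of the two families is assumed summable. After multiplication by
`(γz)_∞ (εz)_∞ (γrz)_∞ (εrz)_∞` both sides are analytic in `|z| < 1` and continuous on `|z| ≤ 1`,
and near `z = 0` they agree by interchange of summations. -/
theorem tsum_quotCoeff_combination {γ ε q : ℂ} (hq0 : q ≠ 0) (hq : ‖q‖ < 1) (hγ0 : γ ≠ 0)
    (hε0 : ε ≠ 0) (δ f r C : ℂ) {a b : ℕ → ℂ} (ha : Summable fun k => ‖a k‖)
    (hb : Summable fun k => ‖b k‖) {B : ℕ → ℂ}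
    (hB : ∀ n, B n = quotCoeff γ δ ε f q n *
      (∑' k, a k * (q ^ k) ^ n - C * r ^ n * ∑' k, b k * (q ^ k) ^ n))
    (hBs : Summable B) :
    qPochInf γ q * qPochInf ε q * (qPochInf (γ * r) q * qPochInf (ε * r) q) * ∑' n, B n =
      qPochInf (γ * r) q * qPochInf (ε * r) q * clearedSeries γ δ ε f q a 1 -
        C * (qPochInf γ q * qPochInf ε q) * clearedSeries γ δ ε f q b r := by
  have hd := differentiable_qPochInf hq
  have hdc : ∀ c, Differentiable ℂ fun z => qPochInf (c * z) q := fun c =>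
    hd.comp (differentiable_id.const_mul c)
  have hdcr : ∀ c, Differentiable ℂ fun z => qPochInf (c * (r * z)) q := fun c =>
    hd.comp ((differentiable_id.const_mul r).const_mul c)
  set H : ℂ → ℂ := fun z => ∑' n, B n * z ^ n with hH
  set D : ℂ → ℂ := fun z => qPochInf (γ * z) q * qPochInf (ε * z) q with hD
  set E : ℂ → ℂ := fun z => qPochInf (γ * (r * z)) q * qPochInf (ε * (r * z)) q with hE
  have hDd : Differentiable ℂ D := (hdc γ).mul (hdc ε)
  have hEd : Differentiable ℂ E := (hdcr γ).mul (hdcr ε)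
  have hbound : ∀ n, ∀ z ∈ Metric.closedBall (0 : ℂ) 1, ‖B n * z ^ n‖ ≤ ‖B n‖ := fun n z hz => by
    rw [norm_mul, norm_pow]
    exact mul_le_of_le_one_right (norm_nonneg _)
      (pow_le_one₀ (norm_nonneg _) (mem_closedBall_zero_iff.1 hz))
  have hHd : DifferentiableOn ℂ H (Metric.ball 0 1) :=
    Complex.differentiableOn_tsum_of_summable_norm hBs.norm (fun n => by fun_prop)
      Metric.isOpen_ball fun n z hz => hbound n z (Metric.ball_subset_closedBall hz)
  have hHc : ContinuousOn H (Metric.closedBall 0 1) :=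
    continuousOn_tsum (fun n => by fun_prop) hBs.norm hbound
  set L : ℂ → ℂ := fun z => D z * E z * H z with hL
  set K : ℂ → ℂ := fun z => E z * clearedSeries γ δ ε f q a z -
    C * D z * clearedSeries γ δ ε f q b (r * z) with hK
  have hKd : Differentiable ℂ K :=
    (hEd.mul (differentiable_clearedSeries hq γ δ ε f ha)).sub ((hDd.const_mul C).mul
      ((differentiable_clearedSeries hq γ δ ε f hb).comp (differentiable_id.const_mul r)))
  have hnear : L =ᶠ[𝓝 0] K := by
    have hsmall : ∀ c : ℂ, ∀ᶠ z in 𝓝 (0 : ℂ), ‖c * z‖ < 1 := fun c => by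
      have : Continuous fun z : ℂ => ‖c * z‖ := by fun_prop
      exact this.continuousAt.eventually_lt continuousAt_const (by simp)
    filter_upwards [hsmall γ, hsmall ε, hsmall (γ * r), hsmall (ε * r)] with z h₁ h₂ h₃ h₄
    rw [mul_assoc] at h₃ h₄
    have s₁ := summable_quotCoeff_mul_tsum hq δ f h₁ h₂ ha
    have s₂ := summable_quotCoeff_mul_tsum hq δ f h₃ h₄ hb
    have e₁ := clearedSeries_eq hq0 hq hγ0 hε0 δ f h₁ h₂ ha
    have e₂ := clearedSeries_eq hq0 hq hγ0 hε0 δ f h₃ h₄ hb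
    have e₃ : H z = ∑' n, quotCoeff γ δ ε f q n * z ^ n * ∑' k, a k * (q ^ k) ^ n -
        C * ∑' n, quotCoeff γ δ ε f q n * (r * z) ^ n * ∑' k, b k * (q ^ k) ^ n := by
      rw [← tsum_mul_left, ← s₁.tsum_sub (s₂.mul_left C)]
      refine tsum_congr fun n => ?_
      rw [hB, mul_pow]
      ring
    simp only [hL, hK, e₃, ← e₁, ← e₂, hD, hE]
    ring
  have hball : Set.EqOn L K (Metric.ball 0 1) :=
    ((((hDd.mul hEd).differentiableOn.mul hHd).analyticOnNhd
      Metric.isOpen_ball).eqOn_of_preconnected_of_eventuallyEq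
      (hKd.differentiableOn.analyticOnNhd Metric.isOpen_ball)
      (convex_ball (0 : ℂ) 1).isPreconnected (by simp) hnear)
  have hclosed : Set.EqOn L K (Metric.closedBall 0 1) :=
    hball.of_subset_closure ((hDd.mul hEd).continuous.continuousOn.mul hHc)
      hKd.continuous.continuousOn Metric.ball_subset_closedBall
      (closure_ball (0 : ℂ) one_ne_zero).ge
  have h1 := hclosed (by simp : (1 : ℂ) ∈ Metric.closedBall (0 : ℂ) 1)
  simpa [hL, hK, hD, hE, hH] using h1

/-! ### The triple sum -/

theorem sum_gaussPoly_mul {q : ℂ} (hq : ‖q‖ < 1) (γ δ ε f : ℂ) (n : ℕ) :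
    ∑ m ∈ Finset.range (n + 1), gaussPoly q n m * qPoch (f / ε) q m * ε ^ m *
      qPoch (δ / γ) q (n - m) * γ ^ (n - m) = qPoch q q n * quotCoeff γ δ ε f q n := by
  rw [quotCoeff, Finset.mul_sum]
  refine Finset.sum_congr rfl fun m hm => ?_
  rw [gaussPoly, if_pos (Nat.lt_succ_iff.1 (Finset.mem_range.1 hm))]
  have hqj := one_sub_mul_pow_ne_zero_of_norm_lt_one hq hq
  have h₁ := qPoch_ne_zero hqj m
  have h₂ := qPoch_ne_zero hqj (n - m)
  generalize qPoch q q m = x at *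
  generalize qPoch q q (n - m) = y at *
  field_simp

theorem tripleTerm_eq {q : ℂ} (hq : ‖q‖ < 1) (α β γ δ ε f t : ℂ) (n : ℕ) :
    tripleTerm α β γ δ ε f q t n =
      quotCoeff γ δ ε f q n * ((q / β) ^ n * qPoch t q n / qPoch (α * t / β) q (n + 1) *
        ∑ p ∈ Finset.range (n + 1), qPoch (α * t / β) q p / qPoch t q p * (β / q) ^ p) := by
  have h := qPoch_ne_zero (one_sub_mul_pow_ne_zero_of_norm_lt_one hq hq) n
  rw [tripleTerm, sum_gaussPoly_mul hq, ← Finset.sum_mul]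
  generalize ∑ p ∈ Finset.range (n + 1), qPoch (α * t / β) q p / qPoch t q p * (β / q) ^ p = s
  generalize qPoch q q n = x at *
  field_simp

theorem norm_quotCoeff_le {q : ℂ} (hq : ‖q‖ < 1) (γ δ ε f : ℂ) :
    ∃ M : ℝ, 0 ≤ M ∧
      ∀ n : ℕ, ‖quotCoeff γ δ ε f q n‖ ≤ M * ((n + 1) * max ‖γ‖ ‖ε‖ ^ n) := by
  have hqj := one_sub_mul_pow_ne_zero_of_norm_lt_one hq hq
  obtain ⟨M₁, h₁0, h₁⟩ := exists_norm_qPoch_div_le hq (f / ε) hqj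
  obtain ⟨M₂, h₂0, h₂⟩ := exists_norm_qPoch_div_le hq (δ / γ) hqj
  refine ⟨M₁ * M₂, by positivity, fun n => ?_⟩
  set ρ := max ‖γ‖ ‖ε‖ with hρ
  have hρ0 : 0 ≤ ρ := (norm_nonneg γ).trans (le_max_left _ _)
  calc ‖quotCoeff γ δ ε f q n‖
      ≤ ∑ m ∈ Finset.range (n + 1), M₁ * M₂ * ρ ^ n := by
        refine norm_sum_le_of_le _ fun m hm => ?_
        have e : ρ ^ n = ρ ^ m * ρ ^ (n - m) := by
          rw [← pow_add, Nat.add_sub_cancel' (Nat.lt_succ_iff.1 (Finset.mem_range.1 hm))]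
        calc ‖qPoch (f / ε) q m / qPoch q q m * ε ^ m *
              (qPoch (δ / γ) q (n - m) / qPoch q q (n - m) * γ ^ (n - m))‖
            ≤ M₁ * ρ ^ m * (M₂ * ρ ^ (n - m)) := by
              rw [norm_mul, norm_mul, norm_mul (_ / _), norm_pow, norm_pow]
              gcongr
              exacts [h₁ m, le_max_right _ _, h₂ _, le_max_left _ _]
          _ = _ := by rw [e]; ring
    _ = M₁ * M₂ * ((n + 1) * ρ ^ n) := by
        rw [Finset.sum_const, Finset.card_range, nsmul_eq_mul]
        push_cast
        ring

theorem summable_tripleTerm {α β γ ε q t : ℂ} (hq0 : q ≠ 0) (hq : ‖q‖ < 1) (ht : ‖t‖ < 1)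
    (hβ0 : β ≠ 0) (δ f : ℂ) (hx : ∀ j : ℕ, 1 - α * t / β * q ^ j ≠ 0)
    (hγ : ‖γ‖ < 1) (hε : ‖ε‖ < 1) (hγβ : ‖γ * q / β‖ < 1) (hεβ : ‖ε * q / β‖ < 1) :
    Summable (tripleTerm α β γ δ ε f q t) := by
  obtain ⟨M₁, h₁0, h₁⟩ := norm_quotCoeff_le hq γ δ ε f
  obtain ⟨M₂, h₂0, h₂⟩ := exists_norm_inv_qPoch_le hq hx
  obtain ⟨M₃, h₃0, h₃⟩ := exists_norm_qPoch_div_le hq (α * t / β)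
    (one_sub_mul_pow_ne_zero_of_norm_lt_one ht hq)
  set T := Real.exp (‖t‖ * (1 - ‖q‖)⁻¹)
  set ρ := max ‖γ‖ ‖ε‖ with hρ
  set s := max 1 ‖q / β‖ with hs
  have hρ0 : 0 ≤ ρ := (norm_nonneg γ).trans (le_max_left _ _)
  have hs1 : 1 ≤ s := le_max_left _ _
  have hs0 : 0 ≤ s := zero_le_one.trans hs1
  have hρs : ‖ρ * s‖ < 1 := by
    rw [Real.norm_of_nonneg (by positivity)]
    rw [mul_div_assoc, norm_mul] at hγβ hεβ
    rcases max_choice ‖γ‖ ‖ε‖ with h | h <;> rcases max_choice 1 ‖q / β‖ with h' | h' <;>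
      rw [hρ, hs, h, h'] <;> simpa only [mul_one]
  have hsum : Summable fun n : ℕ =>
      M₁ * T * M₂ * M₃ * (((n : ℝ) + 1) ^ 2 * (ρ * s) ^ n) := by
    refine Summable.mul_left _ ?_
    have k₂ := summable_pow_mul_geometric_of_norm_lt_one 2 hρs
    have k₁ := (summable_pow_mul_geometric_of_norm_lt_one 1 hρs).mul_left 2
    have k₀ := summable_pow_mul_geometric_of_norm_lt_one 0 hρs
    exact ((k₂.add k₁).add k₀).congr fun n => by ring
  refine Summable.of_norm_bounded hsum fun n => ?_
  have hinner : ‖(q / β) ^ n *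
      ∑ p ∈ Finset.range (n + 1), qPoch (α * t / β) q p / qPoch t q p * (β / q) ^ p‖ ≤
      M₃ * ((n + 1) * s ^ n) := by
    rw [Finset.mul_sum]
    calc _ ≤ ∑ p ∈ Finset.range (n + 1), M₃ * s ^ n := by
          refine norm_sum_le_of_le _ fun p hp => ?_
          have hpn := Nat.lt_succ_iff.1 (Finset.mem_range.1 hp)
          have e : (q / β) ^ n * (qPoch (α * t / β) q p / qPoch t q p * (β / q) ^ p) =
              qPoch (α * t / β) q p / qPoch t q p * (q / β) ^ (n - p) := by
            have e₁ : (q / β) ^ n = (q / β) ^ (n - p) * (q / β) ^ p := by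
              rw [← pow_add, Nat.sub_add_cancel hpn]
            have e₂ : (q / β) ^ p * (β / q) ^ p = 1 := by
              rw [← mul_pow, div_mul_div_cancel₀ hβ0, div_self hq0, one_pow]
            rw [e₁]
            linear_combination
              qPoch (α * t / β) q p / qPoch t q p * (q / β) ^ (n - p) * e₂
          rw [e, norm_mul, norm_pow]
          refine mul_le_mul (h₃ p) ?_ (by positivity) h₃0
          exact (pow_le_pow_left₀ (norm_nonneg _) (le_max_right _ _) _).trans
            (pow_le_pow_right₀ hs1 (Nat.sub_le _ _))
      _ = _ := by
          rw [Finset.sum_const, Finset.card_range, nsmul_eq_mul]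
          push_cast
          ring
  have e : tripleTerm α β γ δ ε f q t n = quotCoeff γ δ ε f q n * ((q / β) ^ n *
      (∑ p ∈ Finset.range (n + 1), qPoch (α * t / β) q p / qPoch t q p * (β / q) ^ p) *
        (qPoch t q n * (qPoch (α * t / β) q (n + 1))⁻¹)) := by
    rw [tripleTerm_eq hq, div_eq_mul_inv _ (qPoch (α * t / β) q (n + 1))]
    ring
  rw [e, norm_mul, norm_mul, norm_mul (qPoch t q n)]
  calc _ ≤ M₁ * ((n + 1) * ρ ^ n) * (M₃ * ((n + 1) * s ^ n) * (T * M₂)) := by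
        gcongr
        exacts [h₁ n, norm_qPoch_le hq t n, h₂ (n + 1)]
    _ = _ := by rw [mul_pow]; ring

/-- The `q`-binomial theorem at `t q^n` expands this quotient in powers of `q^n`. -/
theorem qPoch_div_eq_tsum {α β q t : ℂ} (hq0 : q ≠ 0) (hq : ‖q‖ < 1) (ht : ‖t‖ < 1)
    (hx : ∀ j : ℕ, 1 - α * t / β * q ^ j ≠ 0) (n : ℕ) :
    qPoch t q n / qPoch (α * t / β) q (n + 1) =
      qPochInf t q / qPochInf (α * t / β) q *
        ∑' k, qPoch (α * q / β) q k / qPoch q q k * t ^ k * (q ^ k) ^ n := by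
  have h := ratioSeries_self hq hq0 (norm_mul_pow_lt_one hq ht n) (α * q / β)
  rw [ratioSeries, show α * q / β * (t * q ^ n) = α * t / β * q ^ (n + 1) by ring] at h
  have e : ∀ k, qPoch (α * q / β) q k / qPoch q q k * t ^ k * (q ^ k) ^ n =
      qPoch (α * q / β) q k / qPoch q q k * (t * q ^ n) ^ k := fun k => by
    rw [mul_pow, ← pow_mul, ← pow_mul, mul_comm n k]; ring
  rw [tsum_congr e, h, qPochInf_eq_mul hq t n, qPochInf_eq_mul hq (α * t / β) (n + 1)]
  have n₁ := qPoch_ne_zero hx (n + 1)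
  have n₂ := qPochInf_ne_zero hq (one_sub_mul_mul_pow_ne_zero hx (n + 1))
  have n₃ := qPochInf_ne_zero hq
    (one_sub_mul_pow_ne_zero_of_norm_lt_one (norm_mul_pow_lt_one hq ht n) hq)
  generalize qPochInf (α * t / β * q ^ (n + 1)) q = x at *
  generalize qPochInf (t * q ^ n) q = y at *
  generalize qPoch (α * t / β) q (n + 1) = z at *
  field_simp

theorem clearedSeries_eq_tsum {δ f q z : ℂ} (hq : ‖q‖ < 1) (γ ε : ℂ)
    (hδ : ∀ j : ℕ, 1 - δ * z * q ^ j ≠ 0) (hf : ∀ j : ℕ, 1 - f * z * q ^ j ≠ 0) (a : ℕ → ℂ) :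
    clearedSeries γ δ ε f q a z = qPochInf (δ * z) q * qPochInf (f * z) q *
      ∑' k, a k * (qPoch (γ * z) q k * qPoch (ε * z) q k /
        (qPoch (δ * z) q k * qPoch (f * z) q k)) := by
  rw [clearedSeries, ← tsum_mul_left]
  refine tsum_congr fun k => ?_
  rw [qPochInf_eq_mul hq (δ * z) k, qPochInf_eq_mul hq (f * z) k]
  have n₁ := qPoch_ne_zero hδ k
  have n₂ := qPoch_ne_zero hf k
  generalize qPoch (δ * z) q k = x at *
  generalize qPoch (f * z) q k = y at *
  field_simp

/-! ### Convergence and the identity -/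

theorem summable_qPoch_three {q t b₁ b₂ b₃ : ℂ} (hq : ‖q‖ < 1) (ht : ‖t‖ < 1) (a₁ a₂ a₃ : ℂ)
    (h₁ : ∀ j : ℕ, 1 - b₁ * q ^ j ≠ 0) (h₂ : ∀ j : ℕ, 1 - b₂ * q ^ j ≠ 0)
    (h₃ : ∀ j : ℕ, 1 - b₃ * q ^ j ≠ 0) :
    Summable fun n => qPochs [a₁, a₂, a₃] q n / qPochs [b₁, b₂, b₃] q n * t ^ n := by
  obtain ⟨M₁, h₁0, h₁⟩ := exists_norm_qPoch_div_le hq a₁ h₁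
  obtain ⟨M₂, h₂0, h₂⟩ := exists_norm_qPoch_div_le hq a₂ h₂
  obtain ⟨M₃, h₃0, h₃⟩ := exists_norm_qPoch_div_le hq a₃ h₃
  refine (summable_norm_of_norm_le_mul_pow (M := M₁ * (M₂ * M₃)) ht fun n => ?_).of_norm
  simp only [qPochs, List.map_cons, List.map_nil, List.prod_cons, List.prod_nil, mul_one]
  rw [mul_div_mul_comm, mul_div_mul_comm, norm_mul, norm_mul]
  gcongr
  exacts [h₁ n, h₂ n, h₃ n]

theorem theorem1p1 (α β γ δ ε f q t : ℂ)
    (hq0 : q ≠ 0) (hq : ‖q‖ < 1) (ht0 : t ≠ 0) (ht : ‖t‖ < 1)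
    (hα0 : α ≠ 0) (hβ0 : β ≠ 0) (hγ0 : γ ≠ 0) (hε0 : ε ≠ 0)
    -- note that `t ≠ q^(-j)` for `j ≥ 0` follows from `‖t‖ < 1`
    (hβ : ∀ j : ℕ, β ≠ q ^ (-(j : ℤ)))
    (hδ : ∀ j : ℕ, δ ≠ q ^ (-(j : ℤ)))
    (hf : ∀ j : ℕ, f ≠ q ^ (-(j : ℤ)))
    -- the other denominators in the identity do not vanish
    (hα : ∀ j : ℕ, q / α ≠ q ^ (-(j : ℤ)))
    (hαt : ∀ k : ℤ, α * t / β ≠ q ^ k)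
    (hγβ : ∀ j : ℕ, γ * q / β ≠ q ^ (-(j : ℤ)))
    (hεβ : ∀ j : ℕ, ε * q / β ≠ q ^ (-(j : ℤ)))
    (hδβ : ∀ j : ℕ, δ * q / β ≠ q ^ (-(j : ℤ)))
    (hfβ : ∀ j : ℕ, f * q / β ≠ q ^ (-(j : ℤ))) :
    -- convergence of the series in the identity
    Summable (lhsTerm α β γ δ ε f q t) ∧
    Summable (basicHypTerm [α * q / β, γ * q / β, ε * q / β] [δ * q / β, f * q / β] q t) ∧
    (‖q / α‖ < 1 → Summable (basicHypTerm [q, q / t] [β * q / (α * t)] q (q / α))) ∧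
    (‖γ‖ < 1 → ‖ε‖ < 1 → ‖γ * q / β‖ < 1 → ‖ε * q / β‖ < 1 →
      Summable (tripleTerm α β γ δ ε f q t)) ∧
    -- the identity, whenever the remaining two series converge
    (Summable (basicHypTerm [q, q / t] [β * q / (α * t)] q (q / α)) →
      Summable (tripleTerm α β γ δ ε f q t) →
      ∑' n : ℕ, lhsTerm α β γ δ ε f q t n =
        qPochInfs [ε, γ, β / α, q, α * t, q / (α * t), δ * q / β, f * q / β] q /
            qPochInfs [f, δ, q / α, β, β / (α * t), α * t * q / β, γ * q / β, ε * q / β] q *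
          basicHyp [α * q / β, γ * q / β, ε * q / β] [δ * q / β, f * q / β] q t
        + (1 - q / β) *
            (qPochInfs [ε, γ, t, δ * q / β, f * q / β] q /
              qPochInfs [f, δ, α * t / β, γ * q / β, ε * q / β] q) *
          basicHyp [α * q / β, γ * q / β, ε * q / β] [δ * q / β, f * q / β] q t *
          (basicHyp [q, q / t] [β * q / (α * t)] q (q / α) - 1)
        + qPochInfs [ε, γ] q / qPochInfs [f, δ] q * (1 - q / β) *
          ∑' n : ℕ, tripleTerm α β γ δ ε f q t n) := by
  have hβ := one_sub_mul_pow_ne_zero hβ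
  have hδ := one_sub_mul_pow_ne_zero hδ
  have hf := one_sub_mul_pow_ne_zero hf
  have hα := one_sub_mul_pow_ne_zero hα
  have hγβ := one_sub_mul_pow_ne_zero hγβ
  have hεβ := one_sub_mul_pow_ne_zero hεβ
  have hδβ := one_sub_mul_pow_ne_zero hδβ
  have hfβ := one_sub_mul_pow_ne_zero hfβ
  have hqj := one_sub_mul_pow_ne_zero_of_norm_lt_one hq hq
  have hx : ∀ j : ℕ, 1 - α * t / β * q ^ j ≠ 0 :=
    one_sub_mul_pow_ne_zero fun j => hαt (-(j : ℤ))
  have hy : ∀ j : ℕ, 1 - β / (α * t) * q ^ j ≠ 0 := fun j h0 => by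
    apply hαt j
    rw [zpow_natCast]
    field_simp at h0 ⊢
    linear_combination h0
  have hyq : ∀ j : ℕ, 1 - β * q / (α * t) * q ^ j ≠ 0 := fun j => by
    have := hy (j + 1)
    rwa [show β / (α * t) * q ^ (j + 1) = β * q / (α * t) * q ^ j by ring] at this
  refine ⟨summable_qPoch_three hq ht _ _ _ hβ hδ hf, ?_, fun h => ?_,
    summable_tripleTerm hq0 hq ht hβ0 δ f hx, fun hΦ hT => ?_⟩
  · refine (summable_qPoch_three hq ht (α * q / β) (γ * q / β) (ε * q / β) hqj hδβ hfβ).congr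
      fun n => ?_
    simp [basicHypTerm, qPochs]
  · exact ((summable_norm_qPoch_div hq h _ hyq).of_norm).congr
      fun n => (basicHypTerm_two_one hq _ _ _ n).symm
  -- The factor `1 - q / β` stays on the triple sum throughout, so `β = q` needs no separate case.
  set S := ratioSeries α β q t
  set C := (1 - α * t / β) * S - (1 - q / β) with hC
  set V := qPochInf t q / qPochInf (α * t / β) q with hV
  have ha := summable_norm_qPoch_div hq ht α hβ
  have hb := summable_norm_qPoch_div hq ht (α * q / β) hqj
  have hB : ∀ n, (1 - q / β) * tripleTerm α β γ δ ε f q t n = quotCoeff γ δ ε f q n *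
      (∑' k, qPoch α q k / qPoch β q k * t ^ k * (q ^ k) ^ n - C * V * (q / β) ^ n *
        ∑' k, qPoch (α * q / β) q k / qPoch q q k * t ^ k * (q ^ k) ^ n) := fun n => by
    -- The first family is `S(t q^n)`; the second one recovers `(t)_n / (αt/β)_{n+1}`.
    have e₁ : ∑' k, qPoch α q k / qPoch β q k * t ^ k * (q ^ k) ^ n =
        ratioSeries α β q (t * q ^ n) := tsum_congr fun k => by
      rw [mul_pow, ← pow_mul, ← pow_mul, mul_comm n k]; ring
    rw [e₁, ratioSeries_mul_pow hq0 hq ht hβ0 hβ hx n, tripleTerm_eq hq, ← hC]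
    linear_combination quotCoeff γ δ ε f q n * C * (q / β) ^ n *
      -qPoch_div_eq_tsum hq0 hq ht hx n
  have hmain := tsum_quotCoeff_combination hq0 hq hγ0 hε0 δ f (q / β) (C * V) ha hb hB
    (hT.mul_left _)
  rw [tsum_mul_left, clearedSeries_eq_tsum hq γ ε (by simpa using hδ) (by simpa using hf),
    clearedSeries_eq_tsum hq γ ε (by simpa only [mul_div_assoc] using hδβ)
      (by simpa only [mul_div_assoc] using hfβ)] at hmain
  simp only [mul_one, ← mul_div_assoc] at hmain
  have e₁ : ∑' k, qPoch α q k / qPoch β q k * t ^ k *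
      (qPoch γ q k * qPoch ε q k) / (qPoch δ q k * qPoch f q k) =
        ∑' n, lhsTerm α β γ δ ε f q t n := tsum_congr fun k => by
    simp only [lhsTerm, qPochs, List.map_cons, List.map_nil, List.prod_cons, List.prod_nil,
      mul_one, div_eq_mul_inv, mul_inv]
    ring
  have e₂ : ∑' k, qPoch (α * q / β) q k / qPoch q q k * t ^ k *
      (qPoch (γ * q / β) q k * qPoch (ε * q / β) q k) /
        (qPoch (δ * q / β) q k * qPoch (f * q / β) q k) =
      basicHyp [α * q / β, γ * q / β, ε * q / β] [δ * q / β, f * q / β] q t :=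
    tsum_congr fun k => by
      simp only [basicHypTerm, qPochs, List.map_cons, List.map_nil, List.prod_cons,
        List.prod_nil, mul_one, div_eq_mul_inv, mul_inv]
      ring
  rw [e₁, e₂] at hmain
  have hS := ratioSeries_connection hq0 hq ht ht0 hα0 hβ0 hβ hα hy hΦ
  have hX : qPochInf (α * t / β) q = (1 - α * t / β) * qPochInf (α * t * q / β) q := by
    rw [qPochInf_eq_mul_one hq]; ring_nf
  have hxq : ∀ j : ℕ, 1 - α * t * q / β * q ^ j ≠ 0 := fun j => by
    have := hx (j + 1)
    rwa [show α * t / β * q ^ (j + 1) = α * t * q / β * q ^ j by ring] at this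
  have m₀ := hx 0
  rw [pow_zero, mul_one] at m₀
  have m₁ := qPochInf_ne_zero hq hβ
  have m₂ := qPochInf_ne_zero hq hδ
  have m₃ := qPochInf_ne_zero hq hf
  have m₄ := qPochInf_ne_zero hq hα
  have m₅ := qPochInf_ne_zero hq hγβ
  have m₆ := qPochInf_ne_zero hq hεβ
  have m₇ := qPochInf_ne_zero hq hy
  have m₈ := qPochInf_ne_zero hq hxq
  have m₉ := qPochInf_ne_zero hq (one_sub_mul_pow_ne_zero_of_norm_lt_one ht hq)
  simp only [qPochInfs, List.map_cons, List.map_nil, List.prod_cons, List.prod_nil, mul_one]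
  rw [hC, hS, hV, hX] at hmain
  rw [hX]
  clear hC hS hV hX hB e₁ e₂ C V
  generalize ∑' n, lhsTerm α β γ δ ε f q t n = L at *
  generalize ∑' n, tripleTerm α β γ δ ε f q t n = W at *
  generalize basicHyp [α * q / β, γ * q / β, ε * q / β] [δ * q / β, f * q / β] q t = P at *
  generalize basicHyp [q, q / t] [β * q / (α * t)] q (q / α) = Φ at *
  generalize 1 - α * t / β = x at *
  generalize 1 - q / β = y at *
  generalize qPochInf β q = z₁ at *
  generalize qPochInf δ q = z₂ at *
  generalize qPochInf f q = z₃ at *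
  generalize qPochInf (q / α) q = z₄ at *
  generalize qPochInf (γ * q / β) q = z₅ at *
  generalize qPochInf (ε * q / β) q = z₆ at *
  generalize qPochInf (β / (α * t)) q = z₇ at *
  generalize qPochInf (α * t * q / β) q = z₈ at *
  generalize qPochInf t q = z₉ at *
  generalize qPochInf (δ * q / β) q = y₁ at *
  generalize qPochInf (f * q / β) q = y₂ at *
  generalize qPochInf (β / α) q = y₃ at *
  generalize qPochInf (α * t) q = y₄ at *
  generalize qPochInf (q / (α * t)) q = y₅ at *
  generalize qPochInf q q = y₆ at *
  generalize qPochInf γ q = y₇ at *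
  generalize qPochInf ε q = y₈ at *
  field_simp at hmain ⊢
  linear_combination -hmain
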